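/- Let $k$ be a field of characteristic zero. Let $\mathcal H_{CK}$ be the Connes--Kreimer Hopf algebra: the free commutative $k$-algebra on the (non-empty, non-planar) rooted trees, whose coproduct is the multiplicative extension of $\Delta(t)=\sum v\otimes w$, the sum over all partitions $V\sqcup W$ of the vertex set of the tree $t$ such that $x<y$ for all comparable $x\in W$, $y\in V$ (the order being $x\le y$ iff the path from the root to $y$ passes through $x$), where $v,w$ are the forests induced on $V,W$; its counit $\varepsilon$ vanishes on non-empty forests. Let $B_+$ be the linear operator on $\mathcal H_{CK}$ that grafts the trees of a forest on a common new root. Let $\mathcal A=T(k)$, with basis the words $x^n$ ($n\ge 0$) in one letter $x$, be the quasi-shuffle Hopf algebra: its product $\diamond$ is bilinear with unit $x^0$ and $x^{m+1}\diamond x^{n+1}=x\,(x^m\diamond x^{n+1})+x\,(x^{m+1}\diamond x^n)+x\,(x^m\diamond x^n)$, its coproduct is deconcatenation $\Delta(x^n)=\sum_{i=0}^n x^i\otimes x^{n-i}$, and its counit is the coefficient of $x^0$. Let $L:\mathcal A\to\mathcal A$ be the concatenation operator $x^n\mapsto x^{n+1}$, and let $\Lambda:\mathcal H_{CK}\to\mathcal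 A$ be the algebra morphism defined recursively by $\Lambda(B_+(t_1\cdots t_n))=(\Lambda(t_1)\diamond\cdots\diamond\Lambda(t_n))\,x$. For a linear form $f$ with $f(1)=1$ on either of these coalgebras put $\log^* f=\sum_{n\ge1}\frac{(-1)^{n+1}}{n}(f-\varepsilon)^{*n}$, where $*$ is the convolution product. Let $\delta$ be the character of $\mathcal H_{CK}$ equal to $1$ on the one-vertex tree and to $0$ on all other trees, and let $\widetilde\delta:\mathcal A\to k$ be the linear form with $\widetilde\delta(x^0)=\widetilde\delta(x)=1$ and $\widetilde\delta(x^s)=0$ for $s\ge2$. Set $\omega=\log^*\delta$ and $\widetilde\omega=\log^*\widetilde\delta$. Then: 1. $\Lambda$ is the unique Hopf algebra morphism with $\Lambda\circ B_+=L\circ\Lambda$ (it is compatible with the coproducts and the counits, and it is unique even among algebra morphisms with this property). 2. On every element of $\mathcal H_{CK}$, resp. $\mathcal A$, only finitely many of the convolution powers $(\delta-\varepsilon)^{*n}$, resp. $(\widetilde\delta-\varepsilon)^{*n}$, are non-zero, so that $\omega$ and $\widetilde\omega$ are well defined. 3. $\omega=\widetilde\omega\circ\Lambda$. 4. $\widetilde\omega(x^s)=\dfrac{(-1)^{s+1}}{s}$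 for every $s\ge1$. 5. For every rooted tree $t$ with $|t|$ vertices let $\omega_s(t)$ be the coefficient of $x^s$ in $\Lambda(t)$. Then $\Lambda(t)=\sum_{s=1}^{|t|}\omega_s(t)\,x^s$ and $$\omega(t)=\sum_{s\ge1}\frac{(-1)^{s+1}}{s}\,\omega_s(t).$$ -/

import Mathlib

open scoped TensorProduct

/-! ## Rooted trees -/

/-- Planar rooted trees: a root with an ordered finite family of branches. -/
inductive PTree : Type
  | node (n : ℕ) (c : Fin n → PTree) : PTree

namespace PTree

/-- Isomorphism of the underlying non-planar rooted trees: a bijection between the branches of the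
roots which matches isomorphic branches. -/
def Iso : PTree → PTree → Prop
  | node n c, node m d => ∃ σ : Fin n ≃ Fin m, ∀ i, Iso (c i) (d (σ i))

theorem Iso.refl : ∀ t : PTree, Iso t t
  | node _ c => ⟨Equiv.refl _, fun i => Iso.refl (c i)⟩

theorem Iso.symm : ∀ {s t : PTree}, Iso s t → Iso t s
  | node _ c, node _ d, ⟨σ, h⟩ => ⟨σ.symm, fun i => by
      have := Iso.symm (h (σ.symm i))
      rwa [Equiv.apply_symm_apply] at this⟩

theorem Iso.trans : ∀ {s t u : PTree}, Iso s t → Iso t u → Iso s u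
  | node _ _, node _ _, node _ _, ⟨σ, h⟩, ⟨τ, g⟩ =>
    ⟨σ.trans τ, fun i => Iso.trans (h i) (g (σ i))⟩

instance setoid : Setoid PTree := ⟨Iso, Iso.refl, Iso.symm, Iso.trans⟩

/-- The number of vertices. -/
def numVerts : PTree → ℕ
  | node _ c => 1 + ∑ i, numVerts (c i)

theorem Iso.numVerts_eq : ∀ {s t : PTree}, Iso s t → numVerts s = numVerts t
  | node _ c, node _ d, ⟨σ, h⟩ => by
    simp only [numVerts]
    congr 1
    exact Fintype.sum_equiv σ _ _ fun i => (h i).numVerts_eq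

/-- The vertices of a tree: the root `⊥`, and the vertices of the branches. -/
def Vert : PTree → Type
  | node n c => WithBot (Σ i : Fin n, Vert (c i))

/-- `x ≤ y` if and only if the path from the root to `y` passes through `x`; vertices of distinct
branches are not comparable. -/
instance vertOrder : ∀ t : PTree, PartialOrder (Vert t)
  | node n c =>
    letI : ∀ i, PartialOrder (Vert (c i)) := fun i => vertOrder (c i)
    inferInstanceAs (PartialOrder (WithBot (Σ i : Fin n, Vert (c i))))

instance vertFintype : ∀ t : PTree, Fintype (Vert t)
  | node n c =>
    letI : ∀ i, Fintype (Vert (c i)) := fun i => vertFintype (c i)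
    inferInstanceAs (Fintype (Option (Σ i : Fin n, Vert (c i))))

end PTree

/-- Non-planar (non-empty) rooted trees, up to isomorphism. -/
def RTree : Type := Quotient PTree.setoid

namespace RTree

/-- The tree obtained by grafting the trees of a forest on a common new root. -/
noncomputable def graft (s : Multiset RTree) : RTree :=
  Quotient.mk _ (PTree.node s.toList.length fun i => Quotient.out (s.toList.get i))

/-- The tree with one vertex. -/
noncomputable def bullet : RTree := graft 0

/-- The number of vertices of a rooted tree. -/
def numVerts : RTree → ℕ := Quotient.lift PTree.numVerts fun _ _ h => PTree.Iso.numVerts_eq h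

end RTree

namespace PTree

/-- The root of a tree. -/
def Vert.root {n : ℕ} {c : Fin n → PTree} : Vert (node n c) :=
  (⊥ : WithBot (Σ i : Fin n, Vert (c i)))

/-- The vertex `v` of the `i`-th branch of a tree. -/
def Vert.inBranch {n : ℕ} {c : Fin n → PTree} (i : Fin n) (v : Vert (c i)) : Vert (node n c) :=
  ((⟨i, v⟩ : Σ i : Fin n, Vert (c i)) : WithBot (Σ i : Fin n, Vert (c i)))

/-- The vertices in `W` which belong to the `i`-th branch. -/
def branchSet {n : ℕ} {c : Fin n → PTree} (W : Set (Vert (node n c))) (i : Fin n) :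
    Set (Vert (c i)) := {v | Vert.inBranch i v ∈ W}

open Classical in
/-- The connected components of the forest which a set `W` of vertices of a tree defines, by
keeping the edges which link two elements of `W`. The first entry holds the component of the root
(it is empty if the root is not in `W`), the second entry holds all the other components. -/
noncomputable def components : (t : PTree) → Set (Vert t) → Multiset RTree × Multiset RTree
  | node _ c, W =>
    let A : Multiset RTree := ∑ i, (components (c i) (branchSet W i)).1
    let B : Multiset RTree := ∑ i, (components (c i) (branchSet W i)).2
    if Vert.root ∈ W then ({RTree.graft A}, B) else (0, A + B)

/-- The subforest which a set of vertices of a tree defines. -/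
noncomputable def subforest (t : PTree) (W : Set (Vert t)) : Multiset RTree :=
  (components t W).1 + (components t W).2

/-- The set `W` of vertices is the trunk of an admissible cut (and its complement is the crown):
`x < y` for all comparable vertices `x` in the trunk and `y` in the crown. -/
def IsTrunk (t : PTree) (W : Set (Vert t)) : Prop :=
  ∀ x ∈ W, ∀ y ∈ Wᶜ, x ≤ y ∨ y ≤ x → x < y

end PTree

/-! ## The Connes-Kreimer Hopf algebra -/

/-- The free commutative algebra on the rooted trees. Its monomials are the rooted forests. -/
def HCK (k : Type*) [Field k] : Type _ := MvPolynomial RTree k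

namespace HCK

variable (k : Type*) [Field k]

noncomputable instance : CommRing (HCK k) := inferInstanceAs (CommRing (MvPolynomial RTree k))

noncomputable instance : Algebra k (HCK k) :=
  inferInstanceAs (Algebra k (MvPolynomial RTree k))

/-- The rooted tree `t` as an element of the algebra. -/
noncomputable def tree (t : RTree) : HCK k := MvPolynomial.X (R := k) t

/-- The rooted forest `s` (the product of its trees) as an element of the algebra. -/
noncomputable def forest (s : Multiset RTree) : HCK k := (s.map (tree k)).prod

/-- The algebra morphism with prescribed values on the trees. -/
noncomputable def lift {B : Type*} [CommRing B] [Algebra k B] (f : RTree → B) : HCK k →ₐ[k] B :=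
  MvPolynomial.aeval (R := k) f

/-- The linear operator `B₊`, which grafts the trees of a forest on a common new root. -/
noncomputable def bPlus : HCK k →ₗ[k] HCK k :=
  (MvPolynomial.basisMonomials RTree k).constr k
    fun s => tree k (RTree.graft (Finsupp.toMultiset s))

open Classical in
/-- The sum of `crown ⊗ trunk` over all admissible cuts of a (planar) tree. -/
noncomputable def cutSum (t : PTree) : HCK k ⊗[k] HCK k :=
  ∑ W : Set t.Vert with t.IsTrunk W, forest k (t.subforest Wᶜ) ⊗ₜ[k] forest k (t.subforest W)

end HCK

namespace PTree

theorem Iso.exists_orderIso : ∀ {s t : PTree}, Iso s t →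
    ∃ e : Vert s ≃o Vert t, ∀ W : Set (Vert t), components s (e ⁻¹' W) = components t W
  | node n c, node m d, ⟨σ, h⟩ => by
    choose e he using fun i => Iso.exists_orderIso (h i)
    let E : (Σ i : Fin n, Vert (c i)) ≃ (Σ i : Fin m, Vert (d i)) :=
      Equiv.sigmaCongr σ fun i => (e i).toEquiv
    have hE : ∀ i v, E ⟨i, v⟩ = ⟨σ i, e i v⟩ := fun i v => rfl
    let F : (Σ i : Fin n, Vert (c i)) ≃o (Σ i : Fin m, Vert (d i)) :=
      { E with
        map_rel_iff' := by
          rintro ⟨i, v⟩ ⟨j, w⟩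
          rw [hE, hE]
          constructor
          · intro hle
            obtain rfl : i = j := by
              rw [Sigma.le_def] at hle
              exact σ.injective hle.1
            rw [Sigma.mk_le_mk_iff] at hle ⊢
            exact (e i).le_iff_le.1 hle
          · intro hle
            obtain rfl : i = j := by
              rw [Sigma.le_def] at hle
              exact hle.1
            rw [Sigma.mk_le_mk_iff] at hle ⊢
            exact (e i).le_iff_le.2 hle }
    let G : Vert (node n c) ≃o Vert (node m d) :=
      (F.withBotCongr : WithBot (Σ i : Fin n, Vert (c i)) ≃o WithBot (Σ i : Fin m, Vert (d i)))
    refine ⟨G, fun W => ?_⟩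
    have hb : ∀ i, components (c i) (branchSet (G ⁻¹' W) i) =
        components (d (σ i)) (branchSet W (σ i)) := fun i => he i (branchSet W (σ i))
    have h1 : ∑ i, (components (c i) (branchSet (G ⁻¹' W) i)).1 =
        ∑ i, (components (d i) (branchSet W i)).1 :=
      Fintype.sum_equiv σ _ _ fun i => by rw [hb i]
    have h2 : ∑ i, (components (c i) (branchSet (G ⁻¹' W) i)).2 =
        ∑ i, (components (d i) (branchSet W i)).2 :=
      Fintype.sum_equiv σ _ _ fun i => by rw [hb i]
    have h3 : Vert.root ∈ G ⁻¹' W ↔ Vert.root ∈ W := Iff.rfl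
    simp only [components, h1, h2]
    by_cases hr : Vert.root ∈ W
    · rw [if_pos hr, if_pos (h3.2 hr)]
    · rw [if_neg hr, if_neg (h3.not.2 hr)]

end PTree

namespace HCK

variable (k : Type*) [Field k]

theorem cutSum_eq {s t : PTree} (h : s.Iso t) : cutSum k s = cutSum k t := by
  classical
  obtain ⟨e, he⟩ := h.exists_orderIso
  have hs : ∀ W : Set t.Vert, s.subforest (e ⁻¹' W) = t.subforest W := fun W => by
    simp only [PTree.subforest, he]
  unfold cutSum
  symm
  refine Finset.sum_equiv (Equiv.Set.congr e.toEquiv).symm (fun W => ?_) (fun W _ => ?_)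
  · have hW : (Equiv.Set.congr e.toEquiv).symm W = e ⁻¹' W := by
      change e.symm '' W = e ⁻¹' W
      exact e.symm.toEquiv.image_eq_preimage_symm W
    rw [hW, Finset.mem_filter_univ, Finset.mem_filter_univ]
    unfold PTree.IsTrunk
    constructor
    · intro H x hx y hy hc
      exact e.lt_iff_lt.1 (H (e x) hx (e y) hy (by simpa using hc))
    · intro H x hx y hy hc
      have := H (e.symm x) (by simpa using hx) (e.symm y) (by simpa using hy) (by simpa using hc)
      simpa using this
  · have hW : (Equiv.Set.congr e.toEquiv).symm W = e ⁻¹' W := by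
      change e.symm '' W = e ⁻¹' W
      exact e.symm.toEquiv.image_eq_preimage_symm W
    rw [hW, ← Set.preimage_compl, hs, hs]

/-- The sum of `crown ⊗ trunk` over all admissible cuts of a rooted tree `t` (including the empty
cut and the total cut). -/
noncomputable def comulTree (t : RTree) : HCK k ⊗[k] HCK k :=
  Quotient.lift (cutSum k) (fun _ _ h => cutSum_eq k h) t

/-- The coproduct is the multiplicative extension of the sum over the admissible cuts. The counit
`ε` is `1` on the empty forest and `0` on the other forests. -/
noncomputable instance : CoalgebraStruct k (HCK k) where
  comul := (lift k (comulTree k)).toLinearMap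
  counit := (lift k (fun _ => (0 : k))).toLinearMap

open Classical in
/-- The character `δ` which is `1` on the one-vertex tree and `0` on the other trees. -/
noncomputable def delta : HCK k →ₗ[k] k :=
  (lift k (fun t => if t = RTree.bullet then (1 : k) else 0)).toLinearMap

end HCK

/-! ## The quasi-shuffle Hopf algebra on one letter -/

/-- The vector space `T(k) = k[x]` on the words `xⁿ` in one letter `x`. -/
def QSh (k : Type*) [Field k] : Type _ := ℕ →₀ k

namespace QSh

variable (k : Type*) [Field k]

noncomputable instance : AddCommGroup (QSh k) := inferInstanceAs (AddCommGroup (ℕ →₀ k))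

noncomputable instance : Module k (QSh k) := inferInstanceAs (Module k (ℕ →₀ k))

/-- The word `xⁿ`. -/
noncomputable def word (n : ℕ) : QSh k := Finsupp.single (M := k) n 1

/-- The linear map with prescribed values on the words. -/
noncomputable def lift {B : Type*} [AddCommGroup B] [Module k B] (f : ℕ → B) : QSh k →ₗ[k] B :=
  Finsupp.linearCombination (α := ℕ) k f

/-- The coefficient of the word `xⁿ`. -/
noncomputable def coeff (n : ℕ) : QSh k →ₗ[k] k := Finsupp.lapply (M := k) (R := k) n

/-- Concatenation with the letter `x` (on the right, or equivalently on the left, as there is only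
one letter): `xⁿ ↦ xⁿ⁺¹`. -/
noncomputable def concat : QSh k →ₗ[k] QSh k := lift k fun n => word k (n + 1)

/-- The quasi-shuffle product of the words `xᵏ` and `xˡ`, where `[xx] = x`:
`(x u) ⋄ (x v) = x (u ⋄ x v) + x (x u ⋄ v) + [xx] (u ⋄ v)`. -/
noncomputable def mulWord : ℕ → ℕ → QSh k
  | 0, m => word k m
  | n + 1, 0 => word k (n + 1)
  | n + 1, m + 1 =>
    concat k (mulWord n (m + 1)) + concat k (mulWord (n + 1) m) + concat k (mulWord n m)
  termination_by n m => n + m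

/-- The bilinear extension of the quasi-shuffle product of words. -/
noncomputable def mulLin : QSh k →ₗ[k] QSh k →ₗ[k] QSh k :=
  lift k fun n => lift k fun m => mulWord k n m

noncomputable instance : Mul (QSh k) := ⟨fun a b => mulLin k a b⟩

noncomputable instance : One (QSh k) := ⟨word k 0⟩

variable {k}

theorem lift_word {B : Type*} [AddCommGroup B] [Module k B] (f : ℕ → B) (n : ℕ) :
    lift k f (word k n) = f n := by
  unfold lift word
  erw [Finsupp.linearCombination_single]
  simp

theorem hom_ext {B : Type*} [AddCommGroup B] [Module k B] {f g : QSh k →ₗ[k] B}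
    (h : ∀ n, f (word k n) = g (word k n)) : f = g :=
  Finsupp.lhom_ext' (M := k) (R := k) fun n => LinearMap.ext_ring (h n)

/-- Auxiliary realization of words as functions: `xⁿ ↦ (N ↦ binomial(N, n))`. -/
noncomputable def binom : QSh k →ₗ[k] (ℕ → k) := lift k fun n N => (N.choose n : k)

theorem binom_word (n N : ℕ) : binom (word k n) N = (N.choose n : k) := by
  unfold binom; rw [lift_word]

theorem binom_concat_zero (a : QSh k) : binom (concat k a) 0 = 0 := by
  have : (LinearMap.proj 0 ∘ₗ binom) ∘ₗ concat k = (0 : QSh k →ₗ[k] k) :=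
    hom_ext fun n => by simp [concat, lift_word, binom_word]
  exact LinearMap.congr_fun this a

theorem binom_concat_succ (a : QSh k) (N : ℕ) :
    binom (concat k a) (N + 1) = binom (concat k a) N + binom a N := by
  have : (LinearMap.proj (N + 1) ∘ₗ binom) ∘ₗ concat k =
      (LinearMap.proj N ∘ₗ binom) ∘ₗ concat k + (LinearMap.proj N ∘ₗ binom : QSh k →ₗ[k] k) :=
    hom_ext fun n => by
      simp [concat, lift_word, binom_word, Nat.choose_succ_succ, add_comm]
  exact LinearMap.congr_fun this a

theorem binom_mulWord (n m N : ℕ) :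
    binom (mulWord k n m) N = (N.choose n : k) * (N.choose m : k) := by
  induction n, m using mulWord.induct generalizing N with
  | case1 m => simp [mulWord, binom_word]
  | case2 n => simp [mulWord, binom_word]
  | case3 n m h1 h2 h3 =>
    induction N with
    | zero => simp [mulWord, binom_concat_zero]
    | succ N ih =>
      rw [mulWord] at ih ⊢
      simp only [map_add, Pi.add_apply] at ih
      simp only [map_add, Pi.add_apply, binom_concat_succ, h1, h2, h3]
      rw [Nat.choose_succ_succ, Nat.choose_succ_succ]
      push_cast
      linear_combination ih

theorem binom_mul (a b : QSh k) : binom (a * b) = binom a * binom b := by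
  have : (mulLin k).compr₂ binom =
      (LinearMap.mul k (ℕ → k)).compl₁₂ (binom (k := k)) (binom (k := k)) := by
    refine hom_ext fun n => hom_ext fun m => funext fun N => ?_
    simp [mulLin, lift_word, binom_mulWord, binom_word]
  exact LinearMap.congr_fun₂ this a b

theorem binom_one : binom (1 : QSh k) = 1 := funext fun N => by
  change binom (word k 0) N = 1
  simp [binom_word]

theorem binom_apply (a : QSh k) (N : ℕ) :
    binom a N = ∑ n ∈ Finset.range (N + 1), (N.choose n : k) * coeff k n a := by
  have : (LinearMap.proj N ∘ₗ binom : QSh k →ₗ[k] k) =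
      ∑ n ∈ Finset.range (N + 1), (N.choose n : k) • coeff k n := hom_ext fun m => by
    have hc : ∀ n, coeff k n (word k m) = if m = n then 1 else 0 := fun n => by
      simp only [coeff, word]
      exact Finsupp.single_apply
    simp only [LinearMap.comp_apply, LinearMap.proj_apply, binom_word, LinearMap.sum_apply,
      LinearMap.smul_apply, hc, smul_eq_mul, mul_ite, mul_one, mul_zero, Finset.sum_ite_eq,
      Finset.mem_range]
    split_ifs with h
    · rfl
    · rw [Nat.choose_eq_zero_of_lt (by omega), Nat.cast_zero]
  simpa using LinearMap.congr_fun this a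

theorem binom_injective : Function.Injective (binom (k := k)) := by
  refine (injective_iff_map_eq_zero binom).2 fun a ha => ?_
  have key : ∀ n, coeff k n a = 0 := fun n => by
    induction n using Nat.strong_induction_on with
    | _ n ih =>
      have h := binom_apply a n
      rw [ha, Finset.sum_range_succ, Finset.sum_eq_zero] at h
      · simpa using h.symm
      · intro i hi
        rw [ih i (Finset.mem_range.1 hi), mul_zero]
  exact Finsupp.ext (f := (a : ℕ →₀ k)) (g := (0 : ℕ →₀ k)) key

noncomputable instance : CommRing (QSh k) :=
  { (inferInstance : AddCommGroup (QSh k)) with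
    mul := (· * ·)
    one := 1
    left_distrib := fun a b c => by
      apply binom_injective; simp only [binom_mul, map_add, mul_add]
    right_distrib := fun a b c => by
      apply binom_injective; simp only [binom_mul, map_add, add_mul]
    zero_mul := fun a => by
      apply binom_injective; simp only [binom_mul, map_zero, zero_mul]
    mul_zero := fun a => by
      apply binom_injective; simp only [binom_mul, map_zero, mul_zero]
    mul_assoc := fun a b c => by
      apply binom_injective; simp only [binom_mul, mul_assoc]
    one_mul := fun a => by
      apply binom_injective; simp only [binom_mul, binom_one, one_mul]
    mul_one := fun a => by
      apply binom_injective; simp only [binom_mul, binom_one, mul_one]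
    mul_comm := fun a b => by
      apply binom_injective; simp only [binom_mul, mul_comm] }

noncomputable instance : Algebra k (QSh k) :=
  Algebra.ofModule
    (fun r a b => by
      apply binom_injective; simp only [binom_mul, map_smul, smul_mul_assoc])
    (fun r a b => by
      apply binom_injective; simp only [binom_mul, map_smul, mul_smul_comm])

/-- Deconcatenation of words, and the counit (the coefficient of the empty word). -/
noncomputable instance : CoalgebraStruct k (QSh k) where
  comul := lift k fun n => ∑ p ∈ Finset.HasAntidiagonal.antidiagonal n, word k p.1 ⊗ₜ[k] word k p.2
  counit := coeff k 0

variable (k)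

/-- The linear map `δ̃`, which is `1` on the empty word and on the word `x`, and `0` on all words of
length at least two. -/
noncomputable def delta : QSh k →ₗ[k] k := lift k fun n => if n ≤ 1 then 1 else 0

end QSh

/-! ## The morphism `Λ` -/

/-- The recursion `Λ(B₊(t₁ ⋯ tₙ)) = (Λ(t₁) ⋄ ⋯ ⋄ Λ(tₙ)) x` on planar trees. -/
noncomputable def PTree.toQSh (k : Type*) [Field k] : PTree → QSh k
  | PTree.node _ c => QSh.concat k (∏ i, PTree.toQSh k (c i))

theorem PTree.Iso.toQSh_eq (k : Type*) [Field k] :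
    ∀ {s t : PTree}, s.Iso t → s.toQSh k = t.toQSh k
  | PTree.node _ c, PTree.node _ d, ⟨σ, h⟩ => by
    simp only [PTree.toQSh]
    congr 1
    exact Fintype.prod_equiv σ _ _ fun i => PTree.Iso.toQSh_eq k (h i)

/-- The algebra morphism `Λ` from the Connes-Kreimer algebra to the quasi-shuffle algebra with
`Λ(B₊(t₁ ⋯ tₙ)) = (Λ(t₁) ⋄ ⋯ ⋄ Λ(tₙ)) x`. -/
noncomputable def Lam (k : Type*) [Field k] : HCK k →ₐ[k] QSh k :=
  HCK.lift k fun t => Quotient.lift (PTree.toQSh k) (fun _ _ h => PTree.Iso.toQSh_eq k h) t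

/-! ## Convolution logarithm -/

section Convolution

variable {k C : Type*} [Field k] [AddCommGroup C] [Module k C] [CoalgebraStruct k C]

/-- The powers `f^{*n}` of a linear form for the convolution product
`f * g = m ∘ (f ⊗ g) ∘ Δ`, whose unit is the counit `ε`. -/
noncomputable def convPow (f : C →ₗ[k] k) : ℕ → (C →ₗ[k] k)
  | 0 => CoalgebraStruct.counit
  | n + 1 => (WithConv.toConv (convPow f n) * WithConv.toConv f).ofConv

/-- The convolution logarithm `log* f = K - K^{*2}/2 + K^{*3}/3 - ⋯`, with `K = f - ε`. On each
element the sum is meant to have only finitely many nonzero terms. -/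
noncomputable def convLog (f : C →ₗ[k] k) (u : C) : k :=
  ∑ᶠ n : ℕ, (-1 : k) ^ n / ((n : k) + 1) * convPow (f - CoalgebraStruct.counit) (n + 1) u

end Convolution

/-- The map `ω = log* δ` on the Connes-Kreimer Hopf algebra. -/
noncomputable def omega (k : Type*) [Field k] : HCK k → k := convLog (HCK.delta k)

/-- The map `ω̃ = log* δ̃` on the quasi-shuffle Hopf algebra. -/
noncomputable def omegaTilde (k : Type*) [Field k] : QSh k → k := convLog (QSh.delta k)

/-- `ω_s(t)`: the number of words of length `s` in `Λ(t)`, i.e. the coefficient of `xˢ`. -/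
noncomputable def omegaCoeff (k : Type*) [Field k] (s : ℕ) (t : RTree) : k :=
  QSh.coeff k s (Lam k (HCK.tree k t))

/-! Send the word `xⁿ` to the function `N ↦ binomial(N, n)`. Pascal's rule turns the quasi-shuffle
product into the pointwise product, and Vandermonde's identity turns deconcatenation into `N ↦ N +
M` (`evalTensor_comul`). So every evaluation `eval N` is a character. Evaluation at `0` is the
counit and evaluation at `1` is `δ̃` (`eval_zero`, `eval_one`). Since pairs of evaluations separate
tensors (`evalTensor_injective`), deconcatenation is multiplicative.

Both `B₊` and the concatenation `L` satisfy the cocycle identity `Δ(L u) = L u ⊗ 1 + (id ⊗ L) Δ(u)`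
(`HCK.cutSum_node`, `QSh.comul_concat`). As `Λ` intertwines the two operators and all coproducts are
multiplicative, induction on trees shows that `Λ` respects the coproducts. The same induction gives
uniqueness.

Evaluating `Λ(t)` at `1` yields `δ = δ̃ ∘ Λ` (`Lam.delta`), so all convolution powers, and the
logarithm with them, are pulled back along `Λ`. On words the logarithm is explicit: `δ̃ - ε` is the
coefficient of `x`, and its `n`-th convolution power is the coefficient of `xⁿ`
(`convPow_coeff_one`). Finiteness, the values of `ω̃` and the formula for `ω(t)` follow by reading
off coefficients. -/

namespace QSh

variable {k : Type*} [Field k]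

/-! ### Evaluation characters and the coproduct of the quasi-shuffle algebra. -/

theorem coeff_word (n m : ℕ) : coeff k n (word k m) = if m = n then 1 else 0 := by
  simp only [coeff, word]
  exact Finsupp.single_apply

theorem coeff_ext {a b : QSh k} (h : ∀ n, coeff k n a = coeff k n b) : a = b :=
  Finsupp.ext (f := (a : ℕ →₀ k)) (g := (b : ℕ →₀ k)) h

theorem concat_word (n : ℕ) : concat k (word k n) = word k (n + 1) := lift_word _ n

theorem word_zero : word k 0 = 1 := rfl

theorem comul_word (n : ℕ) : (CoalgebraStruct.comul (word k n) : QSh k ⊗[k] QSh k) =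
    ∑ p ∈ Finset.HasAntidiagonal.antidiagonal n, word k p.1 ⊗ₜ[k] word k p.2 := lift_word _ n

theorem counit_eq_coeff : (CoalgebraStruct.counit : QSh k →ₗ[k] k) = coeff k 0 := rfl

/-- Evaluation of the function `N ↦ ∑ aₙ binomial(N, n)` attached to `∑ aₙ xⁿ`. -/
noncomputable def eval (N : ℕ) : QSh k →ₐ[k] k :=
  AlgHom.ofLinearMap (LinearMap.proj N ∘ₗ binom) (by simp [binom_one])
    (fun a b => by simp [binom_mul])

theorem eval_apply (N : ℕ) (a : QSh k) : eval N a = binom a N := rfl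

theorem eval_word (N n : ℕ) : eval N (word k n) = (N.choose n : k) := binom_word n N

theorem eval_zero : (eval 0 : QSh k →ₐ[k] k).toLinearMap = CoalgebraStruct.counit := by
  refine LinearMap.ext fun a => ?_
  simp [eval_apply, binom_apply, counit_eq_coeff]

/-- This makes `δ̃`, defined only as a linear form, a character: `binomial(1, n)` is `1` for `n ≤ 1`
and `0` afterwards. -/
theorem eval_one : (eval 1 : QSh k →ₐ[k] k).toLinearMap = delta k :=
  hom_ext fun n => by
    rw [delta, lift_word, AlgHom.toLinearMap_apply, eval_word]
    rcases n with _ | _ | n <;> simp [Nat.choose_eq_zero_of_lt]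

/-- The evaluations are a unitriangular combination of the coefficients, with matrix `binomial(N,
n)`, which can be inverted recursively. -/
theorem coeff_mem_span_eval (n : ℕ) :
    coeff k n ∈ Submodule.span k (Set.range fun N => (eval (k := k) N).toLinearMap) := by
  induction n using Nat.strong_induction_on with
  | _ n ih =>
    have h : coeff k n = (eval n).toLinearMap -
        ∑ i ∈ Finset.range n, (n.choose i : k) • coeff k i := by
      refine LinearMap.ext fun a => ?_
      simp [eval_apply, binom_apply, Finset.sum_range_succ]
    rw [h]
    exact Submodule.sub_mem _ (Submodule.subset_span ⟨n, rfl⟩)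
      (Submodule.sum_mem _ fun i hi => Submodule.smul_mem _ _ (ih i (Finset.mem_range.1 hi)))

/-- Evaluation in both tensor factors. -/
noncomputable def evalTensor (N M : ℕ) : QSh k ⊗[k] QSh k →ₐ[k] k :=
  (Algebra.TensorProduct.lmul' k).comp (Algebra.TensorProduct.map (eval N) (eval M))

theorem evalTensor_tmul (N M : ℕ) (a b : QSh k) :
    evalTensor N M (a ⊗ₜ[k] b) = eval N a * eval M b := by
  simp [evalTensor]

variable (k) in
/-- The basis of words. -/
noncomputable def wordBasis : Module.Basis ℕ k (QSh k) :=
  Module.Basis.ofRepr (LinearEquiv.refl k (ℕ →₀ k) :)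

theorem wordBasis_repr_apply (a : QSh k) (n : ℕ) : (wordBasis k).repr a n = coeff k n a := rfl

theorem eq_zero_of_coeff_tensor {z : QSh k ⊗[k] QSh k}
    (h : ∀ n m, LinearMap.mul' k k (TensorProduct.map (coeff k n) (coeff k m) z) = 0) : z = 0 := by
  let B := (wordBasis k).tensorProduct (wordBasis k)
  have key : ∀ n m, ∀ w : QSh k ⊗[k] QSh k, B.repr w (n, m) =
      LinearMap.mul' k k (TensorProduct.map (coeff k n) (coeff k m) w) := fun n m w => by
    induction w using TensorProduct.induction_on with
    | zero => simp
    | tmul a b => simp [B, wordBasis_repr_apply, mul_comm]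
    | add a b ha hb => rw [map_add, map_add, map_add, ← ha, ← hb, Finsupp.add_apply]
  refine B.ext_elem fun ⟨n, m⟩ => ?_
  rw [key, h, map_zero, Finsupp.zero_apply]

/-- For a fixed tensor `y` the pairing `T f g` is bilinear in the two forms. Its vanishing on
evaluations extends to their span, one variable at a time. The span contains all coefficients, and
these determine `y`. -/
theorem evalTensor_injective {z w : QSh k ⊗[k] QSh k}
    (h : ∀ N M, evalTensor N M z = evalTensor N M w) : z = w := by
  rw [← sub_eq_zero]
  set y := z - w with hy
  have h0 : ∀ N M, evalTensor N M y = 0 := fun N M => by rw [hy, map_sub, h, sub_self]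
  let T : (QSh k →ₗ[k] k) →ₗ[k] (QSh k →ₗ[k] k) →ₗ[k] k :=
    (TensorProduct.mapBilinear (RingHom.id k) (QSh k) (QSh k) k k).compr₂
      (LinearMap.mul' k k ∘ₗ LinearMap.applyₗ y)
  have hT : ∀ f g, T f g = LinearMap.mul' k k (TensorProduct.map f g y) := fun f g => rfl
  have h1 : ∀ f ∈ Submodule.span k (Set.range fun N => (eval (k := k) N).toLinearMap),
      ∀ M, T f (eval M).toLinearMap = 0 := fun f hf M => by
    have : Submodule.span k (Set.range fun N => (eval (k := k) N).toLinearMap) ≤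
        LinearMap.ker (T.flip (eval M).toLinearMap) := by
      rw [Submodule.span_le]
      rintro _ ⟨N, rfl⟩
      exact h0 N M
    exact this hf
  have h2 : ∀ f ∈ Submodule.span k (Set.range fun N => (eval (k := k) N).toLinearMap),
      ∀ g ∈ Submodule.span k (Set.range fun N => (eval (k := k) N).toLinearMap),
      T f g = 0 := fun f hf g hg => by
    have : Submodule.span k (Set.range fun N => (eval (k := k) N).toLinearMap) ≤
        LinearMap.ker (T f) := by
      rw [Submodule.span_le]
      rintro _ ⟨N, rfl⟩
      exact h1 f hf N
    exact this hg
  exact eq_zero_of_coeff_tensor fun n m =>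
    h2 _ (coeff_mem_span_eval n) _ (coeff_mem_span_eval m)

/-- On words this is Vandermonde's identity. -/
theorem evalTensor_comul (N M : ℕ) (a : QSh k) :
    evalTensor N M (CoalgebraStruct.comul a) = eval (N + M) a := by
  have : (evalTensor (k := k) N M).toLinearMap ∘ₗ CoalgebraStruct.comul =
      (eval (N + M) : QSh k →ₐ[k] k).toLinearMap := hom_ext fun n => by
    simp only [LinearMap.comp_apply, comul_word, map_sum, AlgHom.toLinearMap_apply,
      evalTensor_tmul, eval_word, Nat.add_choose_eq]
    push_cast
    rfl
  exact LinearMap.congr_fun this a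

variable (k) in
/-- Deconcatenation is a morphism of algebras for the quasi-shuffle product. -/
noncomputable def comulAlgHom : QSh k →ₐ[k] QSh k ⊗[k] QSh k :=
  AlgHom.ofLinearMap CoalgebraStruct.comul
    (evalTensor_injective fun N M => by rw [evalTensor_comul, map_one, map_one])
    (fun a b => evalTensor_injective fun N M => by simp only [evalTensor_comul, map_mul])

theorem comulAlgHom_apply (a : QSh k) : comulAlgHom k a = CoalgebraStruct.comul a := rfl

/-- Either the second factor is empty, or it contains the last letter, which can then be removed.
This is the cocycle identity to be matched with that of `B₊`. -/
theorem comul_concat (a : QSh k) : (CoalgebraStruct.comul (concat k a) : QSh k ⊗[k] QSh k) =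
    concat k a ⊗ₜ[k] 1 + (concat k).lTensor (QSh k) (CoalgebraStruct.comul a) := by
  have : (CoalgebraStruct.comul : QSh k →ₗ[k] QSh k ⊗[k] QSh k) ∘ₗ concat k =
      (TensorProduct.mk k (QSh k) (QSh k)).flip 1 ∘ₗ concat k +
        (concat k).lTensor (QSh k) ∘ₗ CoalgebraStruct.comul := hom_ext fun n => by
    simp only [LinearMap.comp_apply, LinearMap.add_apply, concat_word, comul_word, map_sum,
      LinearMap.lTensor_tmul, LinearMap.flip_apply, TensorProduct.mk_apply]
    rw [Finset.Nat.sum_antidiagonal_succ', word_zero, add_comm]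
  exact LinearMap.congr_fun this a

/-! ### The filtration by word length. -/

theorem coeff_zero_concat (a : QSh k) : coeff k 0 (concat k a) = 0 := by
  have : coeff k 0 ∘ₗ concat k = 0 := hom_ext fun n => by simp [concat_word, coeff_word]
  exact LinearMap.congr_fun this a

theorem eq_sum_of_coeff_eq_zero {a : QSh k} {N : ℕ} (h0 : coeff k 0 a = 0)
    (h : ∀ n, N < n → coeff k n a = 0) :
    a = ∑ s ∈ Finset.Icc 1 N, coeff k s a • word k s := by
  refine coeff_ext fun n => ?_
  simp only [map_sum, map_smul, coeff_word, smul_eq_mul, mul_ite, mul_one, mul_zero,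
    Finset.sum_ite_eq', Finset.mem_Icc]
  split_ifs with hn
  · rfl
  · rcases Nat.eq_zero_or_pos n with rfl | hp
    · exact h0
    · exact h n (by omega)

variable (k) in
/-- The span of the words of length at most `d`. -/
noncomputable def filtration (d : ℕ) : Submodule k (QSh k) :=
  Submodule.span k (word k '' Set.Iic d)

theorem word_mem_filtration {n d : ℕ} (h : n ≤ d) : word k n ∈ filtration k d :=
  Submodule.subset_span ⟨n, h, rfl⟩

theorem filtration_mono {d e : ℕ} (h : d ≤ e) : filtration k d ≤ filtration k e :=
  Submodule.span_mono (Set.image_mono (Set.Iic_subset_Iic.2 h))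

theorem coeff_of_mem_filtration {a : QSh k} {d n : ℕ} (ha : a ∈ filtration k d) (h : d < n) :
    coeff k n a = 0 := by
  have : filtration k d ≤ LinearMap.ker (coeff k n) := by
    rw [filtration, Submodule.span_le]
    rintro _ ⟨m, hm, rfl⟩
    have : m ≠ n := by have := Set.mem_Iic.1 hm; omega
    simp [coeff_word, this]
  exact this ha

theorem concat_mem_filtration {a : QSh k} {d : ℕ} (ha : a ∈ filtration k d) :
    concat k a ∈ filtration k (d + 1) := by
  have : filtration k d ≤ (filtration k (d + 1)).comap (concat k) := by
    rw [filtration, Submodule.span_le]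
    rintro _ ⟨m, hm, rfl⟩
    simp only [SetLike.mem_coe, Submodule.mem_comap, concat_word]
    exact word_mem_filtration (Nat.succ_le_succ hm)
  exact this ha

theorem mulWord_mem_filtration (n m : ℕ) : mulWord k n m ∈ filtration k (n + m) := by
  induction n, m using mulWord.induct with
  | case1 m => rw [mulWord]; exact word_mem_filtration (by omega)
  | case2 n => rw [mulWord]; exact word_mem_filtration (by omega)
  | case3 n m h1 h2 h3 =>
    rw [mulWord]
    refine add_mem (add_mem ?_ ?_) ?_
    · exact filtration_mono (by omega) (concat_mem_filtration h1)
    · exact filtration_mono (by omega) (concat_mem_filtration h2)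
    · exact filtration_mono (by omega) (concat_mem_filtration h3)

theorem mul_mem_filtration {a b : QSh k} {d e : ℕ} (ha : a ∈ filtration k d)
    (hb : b ∈ filtration k e) : a * b ∈ filtration k (d + e) := by
  have hw : ∀ n m, word k n * word k m = mulWord k n m := fun n m => by
    change mulLin k _ _ = _
    rw [mulLin, lift_word, lift_word]
  have h : Submodule.map₂ (mulLin k) (filtration k d) (filtration k e) ≤ filtration k (d + e) := by
    rw [filtration, filtration, Submodule.map₂_span_span, Submodule.span_le]
    rintro _ ⟨_, ⟨n, hn, rfl⟩, _, ⟨m, hm, rfl⟩, rfl⟩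
    change word k n * word k m ∈ _
    rw [hw]
    exact filtration_mono (Nat.add_le_add hn hm) (mulWord_mem_filtration n m)
  exact h (Submodule.apply_mem_map₂ _ ha hb)

theorem prod_mem_filtration {ι : Type*} (s : Finset ι) (a : ι → QSh k) (d : ι → ℕ)
    (h : ∀ i, a i ∈ filtration k (d i)) : ∏ i ∈ s, a i ∈ filtration k (∑ i ∈ s, d i) := by
  classical
  induction s using Finset.induction_on with
  | empty => exact word_mem_filtration le_rfl
  | insert i s hi ih =>
    rw [Finset.prod_insert hi, Finset.sum_insert hi]
    exact mul_mem_filtration (h i) ih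

/-! ### The convolution logarithm on words. -/

theorem delta_sub_counit : delta k - CoalgebraStruct.counit = coeff k 1 := hom_ext fun n => by
  rw [counit_eq_coeff, LinearMap.sub_apply, delta, lift_word, coeff_word, coeff_word]
  rcases n with _ | _ | n <;> simp

/-- Among the splittings of a word only the one into lengths `n` and `1` contributes to the next
power, and it exists only for length `n + 1`. -/
theorem convPow_coeff_one (n : ℕ) : convPow (coeff k 1) n = coeff k n := by
  induction n with
  | zero => rfl
  | succ n ih =>
    refine hom_ext fun m => ?_
    change LinearMap.mul' k k (TensorProduct.map (convPow (coeff k 1) n) (coeff k 1)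
      (CoalgebraStruct.comul (word k m))) = _
    simp only [ih, comul_word, map_sum, TensorProduct.map_tmul, LinearMap.mul'_apply, coeff_word,
      ite_mul, one_mul, zero_mul, ← ite_and]
    by_cases hm : m = n + 1
    · rw [if_pos hm, Finset.sum_eq_single_of_mem (n, 1)]
      · simp
      · simp [hm]
      · rintro ⟨a, b⟩ - h
        exact if_neg fun h' => h (Prod.ext h'.1 h'.2)
    · rw [if_neg hm]
      refine Finset.sum_eq_zero ?_
      rintro ⟨a, b⟩ h
      have hab : a + b = m := Finset.HasAntidiagonal.mem_antidiagonal.1 h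
      exact if_neg fun h' => hm (hab ▸ congrArg₂ (· + ·) h'.1 h'.2)

theorem omegaTilde_eq_sum {a : QSh k} {N : ℕ} (h : ∀ n, N < n → coeff k n a = 0) :
    omegaTilde k a = ∑ s ∈ Finset.Icc 1 N, (-1) ^ (s + 1) / (s : k) * coeff k s a := by
  have hs : (Function.support fun n : ℕ => (-1 : k) ^ n / ((n : k) + 1) * coeff k (n + 1) a) ⊆
      Finset.range N := fun n hn => by
    by_contra hN
    refine hn ?_
    simp only [h (n + 1) (Nat.lt_succ_of_le (by simpa using hN)), mul_zero]
  have h1 : omegaTilde k a =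
      ∑ᶠ n : ℕ, (-1 : k) ^ n / ((n : k) + 1) * coeff k (n + 1) a := by
    simp only [omegaTilde, convLog, delta_sub_counit, convPow_coeff_one]
  -- The series `convLog` is indexed from `0`; the substitution `s = n + 1` accounts for the change
  -- of exponent and denominator.
  rw [h1, finsum_eq_sum_of_support_subset _ hs,
    ← Finset.Ico_add_one_right_eq_Icc, Finset.sum_Ico_eq_sum_range]
  refine Finset.sum_congr rfl fun n _ => ?_
  rw [add_comm 1 n, pow_succ, pow_succ]
  push_cast
  ring

end QSh

/-! ### Trunks, subforests and grafting of rooted trees. -/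

namespace RTree

/-- The class of a planar tree. -/
def mk (t : PTree) : RTree := Quotient.mk _ t

theorem mk_out (r : RTree) : mk (Quotient.out r) = r := Quotient.out_eq r

theorem mk_eq_mk {s t : PTree} : mk s = mk t ↔ s.Iso t := Quotient.eq

theorem graft_eq (s : Multiset RTree) : graft s =
    mk (PTree.node s.toList.length fun i => Quotient.out (s.toList.get i)) := rfl

end RTree

namespace PTree

variable {n : ℕ} {c : Fin n → PTree}

theorem Vert.root_le (v : Vert (node n c)) : Vert.root ≤ v :=
  (bot_le : (⊥ : WithBot (Σ i : Fin n, Vert (c i))) ≤ v)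

theorem Vert.inBranch_le_iff {i : Fin n} {v w : Vert (c i)} :
    (Vert.inBranch i v : Vert (node n c)) ≤ Vert.inBranch i w ↔ v ≤ w :=
  (WithBot.coe_le_coe (α := Σ i : Fin n, Vert (c i))).trans Sigma.mk_le_mk_iff

theorem Vert.eq_of_inBranch_le {i j : Fin n} {v : Vert (c i)} {w : Vert (c j)}
    (h : (Vert.inBranch i v : Vert (node n c)) ≤ Vert.inBranch j w) : i = j :=
  (Sigma.le_def.1 ((WithBot.coe_le_coe (α := Σ i : Fin n, Vert (c i))).1 h)).1

theorem Vert.inBranch_ne_root {i : Fin n} {v : Vert (c i)} :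
    (Vert.inBranch i v : Vert (node n c)) ≠ Vert.root :=
  WithBot.coe_ne_bot (α := Σ i : Fin n, Vert (c i))

theorem Vert.inBranch_injective {i : Fin n} :
    Function.Injective (Vert.inBranch i : Vert (c i) → Vert (node n c)) := fun _ _ h =>
  sigma_mk_injective (β := fun i => Vert (c i)) ((WithBot.coe_injective (α := Σ i : Fin n, Vert (c i))) h)

theorem Vert.eq_root_or_inBranch (x : Vert (node n c)) :
    x = Vert.root ∨ ∃ i v, x = Vert.inBranch i v := by
  rcases x with _ | ⟨i, v⟩
  · exact Or.inl rfl
  · exact Or.inr ⟨i, v, rfl⟩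

theorem Vert.inBranch_lt_iff {i : Fin n} {v w : Vert (c i)} :
    (Vert.inBranch i v : Vert (node n c)) < Vert.inBranch i w ↔ v < w := by
  simp only [lt_iff_le_not_ge, Vert.inBranch_le_iff]

/-- The root lies below every vertex, so a trunk that omits it cannot contain anything. Once the
root is in the trunk, only pairs inside one branch remain comparable, and the condition decouples.
-/
theorem isTrunk_node_iff {W : Set (Vert (node n c))} :
    IsTrunk (node n c) W ↔
      W = ∅ ∨ Vert.root ∈ W ∧ ∀ i, IsTrunk (c i) (branchSet W i) := by
  constructor
  · intro h
    by_cases hr : (Vert.root : Vert (node n c)) ∈ W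
    · refine Or.inr ⟨hr, fun i v hv w hw hc => ?_⟩
      exact Vert.inBranch_lt_iff.1 (h _ hv _ hw (hc.imp Vert.inBranch_le_iff.2
        Vert.inBranch_le_iff.2))
    · refine Or.inl (Set.eq_empty_iff_forall_notMem.2 fun x hx => ?_)
      exact not_lt_of_ge (Vert.root_le x) (h x hx _ hr (Or.inr (Vert.root_le x)))
  · rintro (rfl | ⟨hr, h⟩)
    · intro x hx
      exact absurd hx (Set.notMem_empty x)
    · intro x hx y hy hc
      rcases Vert.eq_root_or_inBranch x with rfl | ⟨i, v, rfl⟩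
      · exact lt_of_le_of_ne (Vert.root_le y) fun e => hy (e ▸ hr)
      · rcases Vert.eq_root_or_inBranch y with rfl | ⟨j, w, rfl⟩
        · exact absurd hr hy
        · obtain rfl : i = j := by
            rcases hc with hc | hc
            · exact Vert.eq_of_inBranch_le hc
            · exact (Vert.eq_of_inBranch_le hc).symm
          exact Vert.inBranch_lt_iff.2 (h i v hx w hy (hc.imp Vert.inBranch_le_iff.1
            Vert.inBranch_le_iff.1))

/-- The set which consists of the root and of prescribed subsets of the branches. -/
def rootedSet (V : ∀ i, Set (Vert (c i))) : Set (Vert (node n c)) :=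
  {x | ∀ i v, x = Vert.inBranch i v → v ∈ V i}

theorem root_mem_rootedSet (V : ∀ i, Set (Vert (c i))) : Vert.root ∈ rootedSet V :=
  fun _ _ h => absurd h.symm Vert.inBranch_ne_root

theorem branchSet_rootedSet (V : ∀ i, Set (Vert (c i))) (i : Fin n) :
    branchSet (rootedSet V) i = V i := by
  ext v
  constructor
  · intro h
    exact h i v rfl
  · intro hv j w h
    obtain rfl : i = j := Vert.eq_of_inBranch_le (le_of_eq h)
    rwa [← Vert.inBranch_injective h]

theorem rootedSet_branchSet {W : Set (Vert (node n c))} (h : Vert.root ∈ W) :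
    rootedSet (branchSet W) = W := by
  ext x
  rcases Vert.eq_root_or_inBranch x with rfl | ⟨i, v, rfl⟩
  · exact iff_of_true (root_mem_rootedSet _) h
  · constructor
    · intro hx
      exact hx i v rfl
    · intro hx j w e
      change Vert.inBranch j w ∈ W
      rwa [← e]

theorem components_of_root_mem {W : Set (Vert (node n c))} (h : Vert.root ∈ W) :
    components (node n c) W =
      ({RTree.graft (∑ i, (components (c i) (branchSet W i)).1)},
        ∑ i, (components (c i) (branchSet W i)).2) := by
  rw [components, if_pos h]

theorem components_of_root_notMem {W : Set (Vert (node n c))} (h : Vert.root ∉ W) :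
    components (node n c) W = (0, ∑ i, subforest (c i) (branchSet W i)) := by
  rw [components, if_neg h]
  simp only [subforest, Finset.sum_add_distrib]

theorem components_empty (t : PTree) : components t ∅ = (0, 0) := by
  induction t with
  | node n c ih =>
    rw [components_of_root_notMem (Set.notMem_empty _)]
    congr 1
    refine Finset.sum_eq_zero fun i _ => ?_
    have : branchSet (∅ : Set (Vert (node n c))) i = ∅ := rfl
    rw [subforest, this, ih]
    rfl

/-- A non-empty trunk is connected to the root, so no component avoids the root. -/
theorem components_snd_of_isTrunk {t : PTree} {W : Set (Vert t)} (h : IsTrunk t W) :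
    (components t W).2 = 0 := by
  induction t with
  | node n c ih =>
    rcases isTrunk_node_iff.1 h with rfl | ⟨hr, h⟩
    · rw [components_empty]
    · rw [components_of_root_mem hr]
      change ∑ i, (components (c i) (branchSet W i)).2 = 0
      exact Finset.sum_eq_zero fun i _ => ih i (h i)

theorem subforest_empty (t : PTree) : subforest t ∅ = 0 := by
  rw [subforest, components_empty]; rfl

theorem subforest_of_root_notMem {W : Set (Vert (node n c))} (h : Vert.root ∉ W) :
    subforest (node n c) W = ∑ i, subforest (c i) (branchSet W i) := by
  rw [subforest, components_of_root_notMem h, zero_add]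

theorem subforest_of_isTrunk {W : Set (Vert (node n c))} (hr : Vert.root ∈ W)
    (h : IsTrunk (node n c) W) :
    subforest (node n c) W = {RTree.graft (∑ i, subforest (c i) (branchSet W i))} := by
  have h2 : ∀ i, (components (c i) (branchSet W i)).2 = 0 := fun i => by
    rcases isTrunk_node_iff.1 h with rfl | ⟨-, h⟩
    · exact absurd hr (Set.notMem_empty _)
    · exact components_snd_of_isTrunk (h i)
  rw [subforest, components_snd_of_isTrunk h, components_of_root_mem hr, add_zero]
  simp only [subforest, h2, add_zero]

/-- Equal multiplicities give, for each isomorphism class, a bijection between the branches in that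
class. These bijections glue to one between all branches. -/
theorem iso_of_sum_singleton_eq {m : ℕ} {d : Fin m → PTree}
    (h : ∑ i, ({RTree.mk (c i)} : Multiset RTree) = ∑ i, {RTree.mk (d i)}) :
    Iso (node n c) (node m d) := by
  classical
  have hcard : ∀ r : RTree, Nonempty ({i // RTree.mk (c i) = r} ≃
      {i // RTree.mk (d i) = r}) := fun r => by
    refine Fintype.card_eq.1 ?_
    have := congrArg (Multiset.count r) h
    simpa [Multiset.count_sum', Multiset.count_singleton, Fintype.card_subtype, eq_comm]
      using this
  refine ⟨Equiv.ofFiberEquiv (fun r => (hcard r).some), fun i => ?_⟩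
  exact RTree.mk_eq_mk.1 (Equiv.ofFiberEquiv_map (fun r => (hcard r).some) i).symm

theorem graft_sum_singleton :
    RTree.graft (∑ i, {RTree.mk (c i)}) = RTree.mk (node n c) := by
  refine RTree.mk_eq_mk.2 (iso_of_sum_singleton_eq ?_)
  -- `RTree.graft` chooses an ordering and representatives; for any multiset `s` these choices
  -- return the same classes.
  generalize ∑ i, ({RTree.mk (c i)} : Multiset RTree) = s
  conv_rhs => rw [← Multiset.coe_toList s]
  simp only [RTree.mk_out, List.get_eq_getElem]
  rw [Fin.sum_univ_fun_getElem s.toList fun r => ({r} : Multiset RTree), ← Multiset.sum_coe,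
    ← Multiset.map_coe, Multiset.sum_map_singleton]

theorem subforest_univ (t : PTree) : subforest t Set.univ = {RTree.mk t} := by
  induction t with
  | node n c ih =>
    have hu : ∀ t : PTree, IsTrunk t Set.univ := fun t x _ y hy => absurd (Set.mem_univ y) hy
    rw [subforest_of_isTrunk (Set.mem_univ _) (hu _), ← graft_sum_singleton]
    have : ∀ i, branchSet (Set.univ : Set (Vert (node n c))) i = Set.univ := fun i => rfl
    simp only [this, ih]

end PTree

namespace RTree

theorem exists_mk_eq (r : RTree) : ∃ t, mk t = r := Quotient.exists_rep r

theorem graft_sum_mk {n : ℕ} (c : Fin n → PTree) :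
    graft (∑ i, {mk (c i)}) = mk (PTree.node n c) := PTree.graft_sum_singleton

end RTree

/-! ### Forests and the cocycle identity for `B₊`. -/

namespace HCK

variable {k : Type*} [Field k]

theorem lift_tree {B : Type*} [CommRing B] [Algebra k B] (f : RTree → B) (t : RTree) :
    lift k f (tree k t) = f t := MvPolynomial.aeval_X f t

theorem algHom_ext {B : Type*} [CommRing B] [Algebra k B] {f g : HCK k →ₐ[k] B}
    (h : ∀ t, f (tree k t) = g (tree k t)) : f = g :=
  MvPolynomial.algHom_ext (R := k) (σ := RTree) h

theorem forest_zero : forest k 0 = 1 := by simp [forest]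

theorem forest_singleton (t : RTree) : forest k {t} = tree k t := by simp [forest]

theorem forest_add (s t : Multiset RTree) : forest k (s + t) = forest k s * forest k t := by
  simp [forest]

theorem forest_sum {ι : Type*} (s : Finset ι) (f : ι → Multiset RTree) :
    forest k (∑ i ∈ s, f i) = ∏ i ∈ s, forest k (f i) := by
  classical
  induction s using Finset.induction_on with
  | empty => exact forest_zero
  | insert i s hi ih => rw [Finset.sum_insert hi, Finset.prod_insert hi, forest_add, ih]

theorem forest_toMultiset (s : RTree →₀ ℕ) :
    forest k (Finsupp.toMultiset s) = MvPolynomial.basisMonomials RTree k s := by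
  change ((Finsupp.toMultiset s).map MvPolynomial.X).prod = MvPolynomial.monomial s (1 : k)
  rw [MvPolynomial.monomial_eq, map_one, one_mul, Finsupp.toMultiset_map, Finsupp.prod_toMultiset]
  exact Finsupp.prod_mapDomain_index (fun _ => pow_zero _) (fun _ _ _ => pow_add _ _ _)

theorem bPlus_forest (s : Multiset RTree) : bPlus k (forest k s) = tree k (RTree.graft s) := by
  classical
  obtain ⟨s, rfl⟩ : ∃ t, Finsupp.toMultiset t = s :=
    ⟨Multiset.toFinsupp s, Multiset.toFinsupp_toMultiset s⟩
  rw [forest_toMultiset]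
  exact (MvPolynomial.basisMonomials RTree k).constr_basis k
    (fun s => tree k (RTree.graft (Finsupp.toMultiset s))) s

theorem linearMap_ext {M : Type*} [AddCommGroup M] [Module k M] {f g : HCK k →ₗ[k] M}
    (h : ∀ s, f (forest k s) = g (forest k s)) : f = g :=
  (MvPolynomial.basisMonomials RTree k).ext fun s => by
    have := h (Finsupp.toMultiset s)
    rwa [forest_toMultiset] at this

variable (k) in
/-- The coproduct as a morphism of algebras. -/
noncomputable def comulAlgHom : HCK k →ₐ[k] HCK k ⊗[k] HCK k := lift k (comulTree k)

theorem comulAlgHom_apply (u : HCK k) : comulAlgHom k u = CoalgebraStruct.comul u := rfl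

theorem comulAlgHom_tree (t : PTree) : comulAlgHom k (tree k (RTree.mk t)) = cutSum k t :=
  lift_tree _ _

theorem _root_.TensorProduct.prod_tmul_prod {R A B ι : Type*} [CommRing R] [CommRing A]
    [CommRing B] [Algebra R A] [Algebra R B] (s : Finset ι) (a : ι → A) (b : ι → B) :
    ∏ i ∈ s, a i ⊗ₜ[R] b i = (∏ i ∈ s, a i) ⊗ₜ[R] ∏ i ∈ s, b i := by
  classical
  induction s using Finset.induction_on with
  | empty => simp [Algebra.TensorProduct.one_def]
  | insert i s hi ih => simp [Finset.prod_insert hi, ih, Algebra.TensorProduct.tmul_mul_tmul]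

-- The empty trunk gives the term `t ⊗ 1`. Every other trunk contains the root and amounts to an
-- independent choice of a trunk in each branch: the crowns multiply, and the trunks are grafted on
-- the root.
open Classical in
theorem cutSum_node {n : ℕ} (c : Fin n → PTree) : cutSum k (PTree.node n c) =
    tree k (RTree.mk (PTree.node n c)) ⊗ₜ[k] 1 +
      (bPlus k).lTensor (HCK k) (∏ i, cutSum k (c i)) := by
  have hset : (Finset.univ.filter fun W => (PTree.node n c).IsTrunk W) =
      insert ∅ ((Fintype.piFinset fun i => Finset.univ.filter fun W => (c i).IsTrunk W).image
        PTree.rootedSet) := by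
    ext W
    simp only [Finset.mem_filter_univ, Finset.mem_insert, Finset.mem_image, Fintype.mem_piFinset]
    rw [PTree.isTrunk_node_iff]
    refine or_congr Iff.rfl ⟨fun h => ⟨_, h.2, PTree.rootedSet_branchSet h.1⟩, ?_⟩
    rintro ⟨V, hV, rfl⟩
    exact ⟨PTree.root_mem_rootedSet V, fun i => by rw [PTree.branchSet_rootedSet]; exact hV i⟩
  have hinj : Function.Injective (PTree.rootedSet (c := c)) := fun V V' h => funext fun i => by
    rw [← PTree.branchSet_rootedSet V, h, PTree.branchSet_rootedSet]
  rw [cutSum, hset, Finset.sum_insert, Finset.sum_image hinj.injOn]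
  · congr 1
    · rw [Set.compl_empty, PTree.subforest_univ, PTree.subforest_empty, forest_singleton,
        forest_zero]
    · unfold cutSum
      rw [Finset.prod_univ_sum, map_sum]
      refine Finset.sum_congr rfl fun V hV => ?_
      have hV' : ∀ i, (c i).IsTrunk (V i) := fun i =>
        (Finset.mem_filter_univ _).1 (Fintype.mem_piFinset.1 hV i)
      have ht : (PTree.node n c).IsTrunk (PTree.rootedSet V) :=
        PTree.isTrunk_node_iff.2 (Or.inr ⟨PTree.root_mem_rootedSet V, fun i => by
          rw [PTree.branchSet_rootedSet]; exact hV' i⟩)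
      have hc : ∀ i, PTree.branchSet (PTree.rootedSet V)ᶜ i = (V i)ᶜ := fun i =>
        congrArg compl (PTree.branchSet_rootedSet V i)
      rw [PTree.subforest_of_root_notMem (Set.notMem_compl_iff.2 (PTree.root_mem_rootedSet V)),
        PTree.subforest_of_isTrunk (PTree.root_mem_rootedSet V) ht, TensorProduct.prod_tmul_prod,
        LinearMap.lTensor_tmul, ← forest_sum, ← forest_sum, bPlus_forest, forest_singleton]
      simp only [hc, PTree.branchSet_rootedSet]
  -- The empty trunk is not counted among the others, which all contain the root.
  · intro h
    obtain ⟨V, -, hV⟩ := Finset.mem_image.1 h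
    have := PTree.root_mem_rootedSet V
    rw [hV] at this
    exact this

end HCK

/-! ### `Λ` as a bialgebra morphism, and the transport of `δ` and of convolution powers. -/

namespace Lam

variable {k : Type*} [Field k]

theorem apply_tree (t : PTree) : Lam k (HCK.tree k (RTree.mk t)) = t.toQSh k := HCK.lift_tree _ _

theorem apply_tree_node {n : ℕ} (c : Fin n → PTree) :
    Lam k (HCK.tree k (RTree.mk (PTree.node n c))) =
      QSh.concat k (∏ i, Lam k (HCK.tree k (RTree.mk (c i)))) := by
  simp only [apply_tree]
  rw [PTree.toQSh]

theorem bPlus (u : HCK k) : Lam k (HCK.bPlus k u) = QSh.concat k (Lam k u) := by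
  have : (Lam k).toLinearMap ∘ₗ HCK.bPlus k = QSh.concat k ∘ₗ (Lam k).toLinearMap :=
    HCK.linearMap_ext fun s => by
      simp only [LinearMap.comp_apply, AlgHom.toLinearMap_apply]
      rw [HCK.bPlus_forest, RTree.graft_eq, apply_tree_node]
      congr 1
      simp only [RTree.mk_out, List.get_eq_getElem]
      rw [Fin.prod_univ_fun_getElem s.toList fun r => Lam k (HCK.tree k r), ← Multiset.prod_coe,
        ← Multiset.map_coe, Multiset.coe_toList, HCK.forest, map_multiset_prod, Multiset.map_map]
      rfl
  exact LinearMap.congr_fun this u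

/-- Each tree is `B₊` of the forest of its branches, so the intertwining relation and
multiplicativity determine the value on it recursively. -/
theorem eq_of_bPlus {f : HCK k →ₐ[k] QSh k} (h : ∀ u, f (HCK.bPlus k u) = QSh.concat k (f u)) :
    f = Lam k := by
  refine HCK.algHom_ext fun r => ?_
  obtain ⟨t, rfl⟩ := RTree.exists_mk_eq r
  induction t with
  | node n c ih =>
    rw [← RTree.graft_sum_mk, ← HCK.bPlus_forest, h, bPlus, HCK.forest_sum, map_prod f,
      map_prod (Lam k)]
    simp only [HCK.forest_singleton, ih]

theorem counit (u : HCK k) : (CoalgebraStruct.counit (Lam k u) : k) = CoalgebraStruct.counit u := by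
  have : (QSh.eval 0).comp (Lam k) = HCK.lift k fun _ => (0 : k) := HCK.algHom_ext fun r => by
    obtain ⟨⟨n, c⟩, rfl⟩ := RTree.exists_mk_eq r
    rw [HCK.lift_tree, AlgHom.comp_apply, apply_tree_node, QSh.eval_apply, QSh.binom_concat_zero]
  rw [← QSh.eval_zero]
  exact DFunLike.congr_fun this u

/-- Both sides are characters, so trees suffice. By Pascal's rule, evaluating a concatenation at `1`
evaluates its argument at `0`. Each of the `n` branches contributes `0` there, and `0 ^ n` is `1`
exactly when the root has no branch. -/
theorem delta (u : HCK k) : QSh.delta k (Lam k u) = HCK.delta k u := by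
  classical
  have : (QSh.eval 1).comp (Lam k) =
      HCK.lift k fun t => if t = RTree.bullet then (1 : k) else 0 := HCK.algHom_ext fun r => by
    obtain ⟨⟨n, c⟩, rfl⟩ := RTree.exists_mk_eq r
    have h0 : ∀ t : PTree, QSh.eval 0 (Lam k (HCK.tree k (RTree.mk t))) = 0 := fun ⟨m, d⟩ => by
      rw [apply_tree_node, QSh.eval_apply, QSh.binom_concat_zero]
    have hb : RTree.mk (PTree.node n c) = RTree.bullet ↔ n = 0 := by
      rw [RTree.bullet, RTree.graft_eq, RTree.mk_eq_mk]
      constructor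
      · rintro ⟨σ, -⟩
        simpa using Fintype.card_congr σ
      · rintro rfl
        exact ⟨finCongr (by simp), fun i => i.elim0⟩
    rw [HCK.lift_tree, AlgHom.comp_apply, apply_tree_node, QSh.eval_apply, QSh.binom_concat_succ,
      QSh.binom_concat_zero, zero_add, ← QSh.eval_apply, map_prod, Finset.prod_congr rfl
        fun i _ => h0 (c i), Finset.prod_const, Finset.card_univ, Fintype.card_fin, zero_pow_eq]
    simp only [hb]
  rw [← QSh.eval_one]
  refine (DFunLike.congr_fun this u).trans ?_
  rw [HCK.delta]
  congr!

/-- Both sides are algebra morphisms, and on trees the two cocycle identities give them the same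
recursion over the branches. -/
theorem comul (u : HCK k) : (CoalgebraStruct.comul (Lam k u) : QSh k ⊗[k] QSh k) =
    TensorProduct.map (Lam k).toLinearMap (Lam k).toLinearMap (CoalgebraStruct.comul u) := by
  have hL : ∀ z : HCK k ⊗[k] HCK k, Algebra.TensorProduct.map (Lam k) (Lam k)
      ((HCK.bPlus k).lTensor (HCK k) z) =
      (QSh.concat k).lTensor (QSh k) (Algebra.TensorProduct.map (Lam k) (Lam k) z) := fun z => by
    induction z using TensorProduct.induction_on with
    | zero => simp only [map_zero]
    | tmul a b => simp only [LinearMap.lTensor_tmul, Algebra.TensorProduct.map_tmul, bPlus]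
    | add a b ha hb => simp only [map_add, ha, hb]
  have : (QSh.comulAlgHom k).comp (Lam k) =
      (Algebra.TensorProduct.map (Lam k) (Lam k)).comp (HCK.comulAlgHom k) := by
    refine HCK.algHom_ext fun r => ?_
    obtain ⟨t, rfl⟩ := RTree.exists_mk_eq r
    simp only [AlgHom.comp_apply, HCK.comulAlgHom_tree]
    induction t with
    | node n c ih =>
      rw [apply_tree_node, QSh.comulAlgHom_apply, QSh.comul_concat, ← QSh.comulAlgHom_apply,
        map_prod (QSh.comulAlgHom k), HCK.cutSum_node, map_add, hL,
        map_prod (Algebra.TensorProduct.map (Lam k) (Lam k)), Algebra.TensorProduct.map_tmul,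
        apply_tree_node, map_one]
      simp only [ih]
  exact DFunLike.congr_fun this u

theorem mem_filtration (t : PTree) :
    Lam k (HCK.tree k (RTree.mk t)) ∈ QSh.filtration k t.numVerts := by
  induction t with
  | node n c ih =>
    rw [apply_tree_node, PTree.numVerts, add_comm]
    exact QSh.concat_mem_filtration (QSh.prod_mem_filtration _ _ _ ih)

/-- Pulling back linear forms along a coalgebra morphism respects convolution and its unit. -/
theorem convPow_comp (f : QSh k →ₗ[k] k) (n : ℕ) (u : HCK k) :
    convPow (f ∘ₗ (Lam k).toLinearMap) n u = convPow f n (Lam k u) := by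
  have : convPow (f ∘ₗ (Lam k).toLinearMap) n = convPow f n ∘ₗ (Lam k).toLinearMap := by
    induction n with
    | zero => exact LinearMap.ext fun u => (counit u).symm
    | succ n ih =>
      refine LinearMap.ext fun u => ?_
      change LinearMap.mul' k k (TensorProduct.map (convPow (f ∘ₗ (Lam k).toLinearMap) n)
        (f ∘ₗ (Lam k).toLinearMap) (CoalgebraStruct.comul u)) =
          LinearMap.mul' k k (TensorProduct.map (convPow f n) f (CoalgebraStruct.comul (Lam k u)))
      rw [ih, comul, TensorProduct.map_comp]
      rfl
  exact LinearMap.congr_fun this u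

theorem delta_sub_counit : HCK.delta k - CoalgebraStruct.counit =
    (QSh.delta k - CoalgebraStruct.counit) ∘ₗ (Lam k).toLinearMap := LinearMap.ext fun u => by
  simp only [LinearMap.sub_apply, LinearMap.comp_apply, AlgHom.toLinearMap_apply, delta, counit]

theorem convPow_delta_sub_counit (n : ℕ) (u : HCK k) :
    convPow (HCK.delta k - CoalgebraStruct.counit) n u =
      convPow (QSh.delta k - CoalgebraStruct.counit) n (Lam k u) := by
  rw [delta_sub_counit, convPow_comp]

theorem omegaTilde (u : HCK k) : omega k u = omegaTilde k (Lam k u) := by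
  simp only [omega, _root_.omegaTilde, convLog, convPow_delta_sub_counit]

theorem coeff_tree_eq_zero {t : RTree} {n : ℕ} (h : t.numVerts < n) :
    QSh.coeff k n (Lam k (HCK.tree k t)) = 0 := by
  obtain ⟨t, rfl⟩ := RTree.exists_mk_eq t
  exact QSh.coeff_of_mem_filtration (mem_filtration t) h

theorem coeff_zero_tree (t : RTree) : QSh.coeff k 0 (Lam k (HCK.tree k t)) = 0 := by
  obtain ⟨⟨n, c⟩, rfl⟩ := RTree.exists_mk_eq t
  rw [apply_tree_node, QSh.coeff_zero_concat]

end Lam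

/-! ### Finiteness, the values of `ω̃` on words, and the conclusion. -/

namespace QSh

variable {k : Type*} [Field k]

theorem exists_coeff_eq_zero (a : QSh k) : ∃ N, ∀ n ≥ N, coeff k n a = 0 := by
  obtain ⟨N, hN⟩ := ((wordBasis k).repr a).support.exists_nat_subset_range
  refine ⟨N, fun n hn => ?_⟩
  by_contra h
  have := Finset.mem_range.1 (hN (Finsupp.mem_support_iff.2 h))
  omega

theorem omegaTilde_word {s : ℕ} (hs : 1 ≤ s) :
    omegaTilde k (word k s) = (-1) ^ (s + 1) / (s : k) := by
  rw [omegaTilde_eq_sum (N := s) fun n hn => by rw [coeff_word, if_neg hn.ne]]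
  simp [coeff_word, hs]

end QSh

theorem mainTheorem8 (k : Type*) [Field k] [CharZero k] :
    -- `Λ` is a morphism of bialgebras (hence of Hopf algebras) with `Λ ∘ B₊ = L ∘ Λ`, and the only
    -- one, where `L` is the concatenation with the letter `x`
    ((∀ u : HCK k, (CoalgebraStruct.comul (Lam k u) : QSh k ⊗[k] QSh k) =
        TensorProduct.map (Lam k).toLinearMap (Lam k).toLinearMap (CoalgebraStruct.comul u)) ∧
      (∀ u : HCK k, (CoalgebraStruct.counit (Lam k u) : k) = CoalgebraStruct.counit u) ∧
      (∀ u : HCK k, Lam k (HCK.bPlus k u) = QSh.concat k (Lam k u)) ∧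
      (∀ Λ' : HCK k →ₐ[k] QSh k,
        (∀ u : HCK k, Λ' (HCK.bPlus k u) = QSh.concat k (Λ' u)) → Λ' = Lam k)) ∧
    -- the series which define `log* δ` and `log* δ̃` are finite sums on each element
    ((∀ u : HCK k, ∃ N : ℕ, ∀ n ≥ N,
        convPow (HCK.delta k - CoalgebraStruct.counit) n u = 0) ∧
      (∀ a : QSh k, ∃ N : ℕ, ∀ n ≥ N,
        convPow (QSh.delta k - CoalgebraStruct.counit) n a = 0)) ∧
    -- `ω = ω̃ ∘ Λ`, and the values of `ω̃` on the words
    (∀ u : HCK k, omega k u = omegaTilde k (Lam k u)) ∧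
    (∀ s : ℕ, 1 ≤ s → omegaTilde k (QSh.word k s) = (-1) ^ (s + 1) / (s : k)) ∧
    -- the formula for `ω(t)`; the coefficients `ω_s(t)` with `s > |t|` vanish
    (∀ t : RTree,
      Lam k (HCK.tree k t) =
        ∑ s ∈ Finset.Icc 1 t.numVerts, omegaCoeff k s t • QSh.word k s ∧
      ∀ N : ℕ, t.numVerts ≤ N →
        omega k (HCK.tree k t) =
          ∑ s ∈ Finset.Icc 1 N, (-1) ^ (s + 1) / (s : k) * omegaCoeff k s t) := by
  refine ⟨⟨Lam.comul, Lam.counit, Lam.bPlus, fun _ => Lam.eq_of_bPlus⟩, ⟨fun u => ?_, fun a => ?_⟩,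
    Lam.omegaTilde, fun s hs => QSh.omegaTilde_word hs, fun t => ⟨?_, fun N hN => ?_⟩⟩
  -- The `n`-th convolution power at `u` is the coefficient of `xⁿ` in `Λ(u)`, so finite support
  -- suffices.
  · simp only [Lam.convPow_delta_sub_counit, QSh.delta_sub_counit, QSh.convPow_coeff_one]
    exact QSh.exists_coeff_eq_zero _
  · simp only [QSh.delta_sub_counit, QSh.convPow_coeff_one]
    exact QSh.exists_coeff_eq_zero a
  · exact QSh.eq_sum_of_coeff_eq_zero (Lam.coeff_zero_tree t) fun n => Lam.coeff_tree_eq_zero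
  · rw [Lam.omegaTilde]
    exact QSh.omegaTilde_eq_sum fun n hn => Lam.coeff_tree_eq_zero (lt_of_le_of_lt hN hn)
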